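/- Let $F$ be a field of characteristic different from $2$ and $3$; all vector spaces are over $F$ and of arbitrary dimension. A *Kantor triple system* $(U,xyz)$ is a vector space $U$ with a trilinear product $U\times U\times U\to U$, $(x,y,z)\mapsto xyz$, such that, with $L(x,y)z=xyz$ and $K(x,y)z=xzy-yzx$, $$uv(xyz)=(uvx)yz-x(vuy)z+xy(uvz),\qquad K(K(u,v)x,y)=K(u,v)L(x,y)+L(y,x)K(u,v)$$ for all $u,v,x,y,z\in U$. An element $e\in U$ is a *left unit* if $eex=x$ for all $x\in U$; then put $\rho(x)=xee$ and $\mu(x)=exe$. A *structurable algebra* $(A,\cdot,\bar{\ })$ is a unital, not necessarily associative, algebra with a linear involution (that is, $\bar{\bar x}=x$ and $\overline{x\cdot y}=\bar y\cdot\bar x$) such that, with $(x,y,z)=(x\cdot y)\cdot z-x\cdot(y\cdot z)$ and $V_{x,y}(z)=(x\cdot\bar y)\cdot z+(z\cdot\bar y)\cdot x-(z\cdot\bar x)\cdot y$, $$(x-\bar x,y,z)=(y,\bar x-x,z),\qquad [V_{u,v},V_{x,y}]=V_{V_{u,v}x,\,y}-V_{x,\,V_{v,u}y}$$ for all $u,v,x,y,z\in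 A$. An *involutive automorphism* of it is a linear map $\sigma$ with $\sigma(x\cdot y)=\sigma(x)\cdot\sigma(y)$, $\sigma(\bar x)=\overline{\sigma(x)}$ and $\sigma^2=\mathrm{id}$ (the identity is allowed). **Theorem 2.7.** (1) Let $(U,xyz)$ be a Kantor triple system with left unit $e$. Then $\mu$ is invertible. Put $\sigma=\mu^{-1}(3\,\mathrm{id}-2\rho)$ and $$\bar x=2x-xee,\qquad x\cdot y=\bar x e y-\bar x\,\sigma(\bar y)\,e+yex\qquad(x,y\in U).\tag{$*$}$$ Then $(U,\cdot,\bar{\ })$ is a structurable algebra with unity $e$, $\sigma$ is an involutive automorphism of $(U,\cdot,\bar{\ })$, and for all $x,y,z\in U$ $$xyz=V_{x,\sigma(y)}(z)=(x\cdot\sigma(\bar y))\cdot z+(z\cdot\sigma(\bar y))\cdot x-(z\cdot\bar x)\cdot\sigma(y).\tag{$**$}$$ (2) Conversely, let $(A,\cdot,\bar{\ })$ be a structurable algebra with unity $e$ and an involutive automorphism $\sigma$, and define a triple product $xyz$ on $A$ by $(**)$. Then $(A,xyz)$ is a Kantor triple system with left unit $e$. Moreover, for $\rho(x)=xee$ and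 $\mu(x)=exe$ formed with this triple product, $\mu$ is invertible, $\sigma=\mu^{-1}(3\,\mathrm{id}-2\rho)$, and the involution and the multiplication of $A$ are given by $(*)$. Thus the two constructions are inverse to each other. -/

import Mathlib

/-- A triple product on the `F`-vector space `U`: a trilinear map `(x, y, z) ↦ T x y z`. -/
abbrev TripleProduct (F U : Type*) [Field F] [AddCommGroup U] [Module F U] :=
  U →ₗ[F] U →ₗ[F] U →ₗ[F] U

namespace TripleProduct

section

variable {F U : Type*} [Field F] [AddCommGroup U] [Module F U]

/-- The operator `L(x, y) : z ↦ xyz`. -/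
def L (T : TripleProduct F U) (x y : U) : Module.End F U := T x y

/-- The operator `K(x, y) : z ↦ xzy - yzx`. -/
def K (T : TripleProduct F U) (x y : U) : Module.End F U := (T x).flip y - (T y).flip x

theorem L_apply (T : TripleProduct F U) (x y z : U) : T.L x y z = T x y z := rfl

theorem K_apply (T : TripleProduct F U) (x y z : U) : T.K x y z = T x z y - T y z x := rfl

/-- Generalized Jordan triple systems. -/
structure IsGeneralizedJordan (T : TripleProduct F U) : Prop where
  jordan : ∀ u v x y z : U,
    T u v (T x y z) = T (T u v x) y z - T x (T v u y) z + T x y (T u v z)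

/-- Kantor triple systems (generalized Jordan triple systems of second order). -/
structure IsKantor (T : TripleProduct F U) : Prop extends IsGeneralizedJordan T where
  kantor : ∀ u v x y : U,
    T.K (T.K u v x) y = T.K u v * T.L x y + T.L y x * T.K u v

/-- `e` is a left unit: `eex = x` for all `x`. -/
def IsLeftUnit (T : TripleProduct F U) (e : U) : Prop := ∀ x : U, T e e x = x

/-- `ρ : x ↦ xee`. -/
def rho (T : TripleProduct F U) (e : U) : Module.End F U := (T.flip e).flip e

/-- `μ : x ↦ exe`. -/
def mu (T : TripleProduct F U) (e : U) : Module.End F U := (T e).flip e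

theorem rho_apply (T : TripleProduct F U) (e x : U) : T.rho e x = T x e e := rfl

theorem mu_apply (T : TripleProduct F U) (e x : U) : T.mu e x = T e x e := rfl

/-- `σ = μ⁻¹ (3 id - 2 ρ)`. The inverse is the one in the ring of linear endomorphisms; it is the
genuine inverse of `μ` when `μ` is invertible. -/
noncomputable def sigma (T : TripleProduct F U) (e : U) : Module.End F U :=
  Ring.inverse (T.mu e) * ((3 : F) • LinearMap.id - (2 : F) • T.rho e)

/-- `x ↦ 2x - xee`. -/
def bar (T : TripleProduct F U) (e : U) : U →ₗ[F] U := (2 : F) • LinearMap.id - T.rho e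

theorem bar_apply (T : TripleProduct F U) (e x : U) : T.bar e x = (2 : F) • x - T x e e := rfl

/-- The multiplication `x · y = x̄ey - x̄σ(ȳ)e + yex`, with `x̄ = 2x - xee` and
`σ = μ⁻¹ (3 id - 2 ρ)`. -/
noncomputable def mul (T : TripleProduct F U) (e : U) : U →ₗ[F] U →ₗ[F] U :=
  LinearMap.mk₂ F
    (fun x y => T (T.bar e x) e y - T (T.bar e x) (T.sigma e (T.bar e y)) e + T y e x)
    (fun x x' y => by simp only [map_add, LinearMap.add_apply]; abel)
    (fun c x y => by
      simp only [map_smul, LinearMap.smul_apply, smul_add, smul_sub])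
    (fun x y y' => by simp only [map_add, LinearMap.add_apply]; abel)
    (fun c x y => by
      simp only [map_smul, LinearMap.smul_apply, smul_add, smul_sub])

theorem mul_apply (T : TripleProduct F U) (e x y : U) :
    T.mul e x y =
      T (T.bar e x) e y - T (T.bar e x) (T.sigma e (T.bar e y)) e + T y e x := rfl

end

end TripleProduct

namespace Structurable

section

variable {F A : Type*} [Field F] [AddCommGroup A] [Module F A]

/-- The associator `(x, y, z) = (x · y) · z - x · (y · z)`. -/
def assoc (m : A →ₗ[F] A →ₗ[F] A) (x y z : A) : A := m (m x y) z - m x (m y z)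

/-- The operators `V_{x,y} : z ↦ (x · ȳ) · z + (z · ȳ) · x - (z · x̄) · y`, as a trilinear map
`(x, y, z) ↦ V_{x,y} z`. -/
def V (m : A →ₗ[F] A →ₗ[F] A) (b : A →ₗ[F] A) : A →ₗ[F] A →ₗ[F] Module.End F A :=
  LinearMap.mk₂ F
    (fun x y => m (m x (b y)) + m.flip x ∘ₗ m.flip (b y) - m.flip y ∘ₗ m.flip (b x))
    (fun x x' y => by ext z; simp; abel)
    (fun c x y => by ext z; simp [smul_add, smul_sub])
    (fun x y y' => by ext z; simp; abel)
    (fun c x y => by ext z; simp [smul_add, smul_sub])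

theorem V_apply (m : A →ₗ[F] A →ₗ[F] A) (b : A →ₗ[F] A) (x y z : A) :
    V m b x y z = m (m x (b y)) z + m (m z (b y)) x - m (m z (b x)) y := rfl

/-- The multiplication `m` and the linear map `b` (written `x ↦ x̄`) make the vector space `A`
into a structurable algebra with unity `e`. -/
structure IsStructurable (m : A →ₗ[F] A →ₗ[F] A) (b : A →ₗ[F] A) (e : A) : Prop where
  one_mul : ∀ x : A, m e x = x
  mul_one : ∀ x : A, m x e = x
  bar_bar : ∀ x : A, b (b x) = x
  bar_mul : ∀ x y : A, b (m x y) = m (b y) (b x)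
  skew_assoc : ∀ x y z : A, assoc m (x - b x) y z = assoc m y (b x - x) z
  V_bracket : ∀ u v x y : A,
    ⁅V m b u v, V m b x y⁆ = V m b (V m b u v x) y - V m b x (V m b v u y)

/-- `s` is an involutive automorphism of the algebra with involution given by `m` and `b`
(the identity is allowed). -/
structure IsInvolutiveAutomorphism (m : A →ₗ[F] A →ₗ[F] A) (b : A →ₗ[F] A)
    (s : Module.End F A) : Prop where
  map_mul : ∀ x y : A, s (m x y) = m (s x) (s y)
  map_bar : ∀ x : A, s (b x) = b (s x)
  involutive : ∀ x : A, s (s x) = x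

/-- The triple product `xyz = V_{x,s(y)} z`. -/
def triple (m : A →ₗ[F] A →ₗ[F] A) (b : A →ₗ[F] A) (s : Module.End F A) :
    TripleProduct F A :=
  (V m b).compl₂ s

theorem triple_apply (m : A →ₗ[F] A →ₗ[F] A) (b : A →ₗ[F] A) (s : Module.End F A) (x y z : A) :
    triple m b s x y z = V m b x (s y) z := rfl

end

end Structurable

/-! The axioms at the unit give `(ρ - 1)(ρ - 3) = 0`, `μ² = ρ²` and `ρμ = μρ`. Hence `b = 2 - ρ` is
an involution, `μ` is invertible, `s = μ⁻¹(2b - 1)` squares to the identity, and `exz = b(s x)ez`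
(`IsKantor.isLeftUnital`). Splitting vectors into `b`-fixed and `b`-negated parts determines `K(q,
e)` and shows that `s` is an automorphism of the triple product (`s_triple`), so replacing `y` by `s
y` reduces to `s = id` (`twist`). In that case `K(x, y)` is left multiplication by `x·ȳ - y·x̄`, and
`L(x, y) + L(y, x)` is left multiplication by `x·ȳ + y·x̄`. The operators `V` satisfy the same two
laws, which forces `T = V` (`eq_V`). The Jordan identity is then the bracket identity, and the
Kantor identity yields skew-alternativity. Conversely, in a structurable algebra the Kantor identity
says that `L_q V_{x,y} + V_{y,x} L_q` is a left multiplication for skew `q` (`mul_V`). -/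

theorem three_ne_zero_of_ringChar {F : Type*} [Field F] (h3 : ringChar F ≠ 3) : (3 : F) ≠ 0 := by
  intro h
  have hd : ringChar F ∣ 3 := (ringChar.spec F 3).mp (by exact_mod_cast h)
  rcases (Nat.dvd_prime Nat.prime_three).mp hd with h1 | h1
  · have := (ringChar.spec F 1).mpr (by rw [h1])
    simp at this
  · exact h3 h1

/-- A linear involution splits every vector into a fixed and a negated part. -/
theorem exists_fixed_add_negated {F U : Type*} [Field F] [AddCommGroup U] [Module F U]
    (h2 : (2 : F) ≠ 0) {b : U →ₗ[F] U} (hb : ∀ x, b (b x) = x) (x : U) :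
    ∃ h q : U, b h = h ∧ b q = -q ∧ x = h + q := by
  refine ⟨(2 : F)⁻¹ • (x + b x), (2 : F)⁻¹ • (x - b x), ?_, ?_, ?_⟩
  · rw [map_smul, map_add, hb, add_comm]
  · rw [map_smul, map_sub, hb, ← smul_neg, neg_sub]
  · rw [← smul_add, show x + b x + (x - b x) = (2 : F) • x by module, smul_smul,
      inv_mul_cancel₀ h2, one_smul]

theorem eq_of_two_bar_sub_eq {F U : Type*} [Field F] [AddCommGroup U] [Module F U]
    (h3 : (3 : F) ≠ 0) {b : U →ₗ[F] U} (hb : ∀ x, b (b x) = x) {x y : U}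
    (h : (2 : F) • b x - x = (2 : F) • b y - y) : x = y := by
  have h' := congrArg b h
  simp only [map_sub, map_smul, hb] at h'
  apply smul_right_injective U h3
  linear_combination (norm := module) (2 : F) • h' + h

/-! ### Consequences of the unit relations: `s` is an automorphism of the triple product. -/

namespace TripleProduct

variable {F U : Type*} [Field F] [AddCommGroup U] [Module F U]

theorem IsKantor.kantor_apply {T : TripleProduct F U} (hT : T.IsKantor) (u v x y z : U) :
    T.K (T.K u v x) y z = T.K u v (T x y z) + T y x (T.K u v z) := by
  rw [hT.kantor]; rfl

/-- The relations between the operators `b`, `s` and the triple product `T` that hold in a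
Kantor triple system with left unit `e`, for `b` its involution and `s` its automorphism. -/
structure IsLeftUnital (T : TripleProduct F U) (e : U) (b s : U →ₗ[F] U) : Prop where
  two_ne : (2 : F) ≠ 0
  three_ne : (3 : F) ≠ 0
  kantor : T.IsKantor
  left : ∀ x, T e e x = x
  bb : ∀ x, b (b x) = x
  ss : ∀ x, s (s x) = x
  sb : ∀ x, s (b x) = b (s x)
  rho : ∀ x, T x e e = (2 : F) • x - b x
  mu : ∀ x, T e x e = (2 : F) • b (s x) - s x
  swap : ∀ x z, T e x z = T (b (s x)) e z

namespace IsLeftUnital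

variable {T : TripleProduct F U} {e : U} {b s : U →ₗ[F] U}

/-- The Kantor identity at `x = y = e`. It reduces every `K(u, v)` to operators of the form `K(w,
e)`. -/
theorem K_e (D : T.IsLeftUnital e b s) (u v z : U) :
    T.K (T.K u v e) e z = (2 : F) • T.K u v z := by
  rw [D.kantor.kantor_apply, D.left, D.left, two_smul]

theorem b_e (D : T.IsLeftUnital e b s) : b e = e := by
  have h := D.rho e
  rw [D.left] at h
  linear_combination (norm := module) h

theorem s_e (D : T.IsLeftUnital e b s) : s e = e := by
  have h := D.mu e
  rw [D.left] at h
  apply eq_of_two_bar_sub_eq D.three_ne D.bb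
  rw [← h, D.b_e]; module

theorem K_fixed (D : T.IsLeftUnital e b s) {h : U} (hh : b h = h) (x : U) :
    T h x e = T e x h := by
  have h1 := D.K_e h e x
  have h0 : T.K h e e = 0 := by
    rw [K_apply, D.rho, D.left, hh]; module
  rw [h0] at h1
  have h2 : T.K h e x = 0 := by
    apply smul_right_injective U D.two_ne
    simp only [smul_zero, ← h1]
    simp [K_apply]
  rw [K_apply] at h2
  exact sub_eq_zero.mp h2

theorem K_negated_e (D : T.IsLeftUnital e b s) {q : U} (hq : b q = -q) :
    T.K q e e = (2 : F) • q := by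
  rw [K_apply, D.rho, D.left, hq]; module

theorem bar_K_negated (D : T.IsLeftUnital e b s) {q : U} (hq : b q = -q) (x : U) :
    b (T.K q e x) = T.K q e (b x) - T.K q e x - (2 : F) • T e x q := by
  have h := D.kantor.kantor_apply q e x e e
  rw [K_apply T (T.K q e x), D.rho, D.left, D.K_negated_e hq, D.rho] at h
  simp only [map_sub, map_smul] at h
  linear_combination (norm := module) -h

theorem K_negated_fixed (D : T.IsLeftUnital e b s) {q h : U} (hq : b q = -q) (hh : b h = h) :
    T.K q e h = -(2 : F) • b (T (s h) e q) := by
  have h1 := congrArg b (D.bar_K_negated hq h)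
  rw [hh, D.bb, D.swap, ← D.sb, hh] at h1
  simp only [map_sub, map_smul] at h1
  linear_combination (norm := module) h1

/-- `bar_K_negated` and its image under `b` are two linear equations in `K(q, e)t` and its
conjugate; eliminating the latter leaves the factor 3. -/
theorem K_negated_negated (D : T.IsLeftUnital e b s) {q t : U} (hq : b q = -q) (ht : b t = -t) :
    (3 : F) • T.K q e t = (4 : F) • T (s t) e q - (2 : F) • b (T (s t) e q) := by
  have h1 := D.bar_K_negated hq t
  rw [ht, D.swap, ← D.sb, ht] at h1
  have h2 := congrArg b h1
  simp only [map_sub, map_smul, map_neg, LinearMap.neg_apply, D.bb] at h1 h2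
  linear_combination (norm := module) (2 : F) • h1 - h2

theorem jordan_rho (D : T.IsLeftUnital e b s) (x z : U) :
    b (T x e z) - T x e (b z) =
      T z e ((2 : F) • x - b x) - T z ((2 : F) • b (s x) - s x) e := by
  have h := D.kantor.jordan x e z e e
  rw [D.rho z, D.rho, D.rho x, D.mu] at h
  simp only [map_sub, map_smul, LinearMap.sub_apply, LinearMap.smul_apply] at h ⊢
  linear_combination (norm := module) h

theorem jordan_mu (D : T.IsLeftUnital e b s) (x z : U) :
    T x e ((2 : F) • b (s z) - s z) = T ((2 : F) • x - b x) z e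
      - ((2 : F) • b (s (T e x z)) - s (T e x z)) + T e z ((2 : F) • x - b x) := by
  have h := D.kantor.jordan x e e z e
  rwa [D.rho, D.mu, D.mu] at h

theorem bar_fixed_fixed (D : T.IsLeftUnital e b s) {h k : U} (hh : b h = h) (hk : b k = k) :
    b (T h e k) = T k e h := by
  have h1 := D.jordan_rho h k
  rw [← D.sb, hh, hk] at h1
  simp only [map_sub, map_smul, LinearMap.sub_apply, LinearMap.smul_apply] at h1
  rw [D.K_fixed hk, D.swap, D.ss, hh] at h1
  linear_combination (norm := module) h1

theorem negated_fixed (D : T.IsLeftUnital e b s) {q h : U} (hq : b q = -q) (hh : b h = h) :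
    T q e h = (2 : F) • T h e q - b (T h e q) := by
  have h1 := D.jordan_rho h q
  have hs : b (s h) = s h := by rw [← D.sb, hh]
  have h2 := D.K_negated_fixed hq hs
  rw [K_apply, D.ss, D.swap, D.ss, hh] at h2
  rw [hs, hh, hq] at h1
  simp only [map_sub, map_smul, map_neg, LinearMap.sub_apply, LinearMap.smul_apply] at h1
  linear_combination (norm := module) -h1 + h2

theorem bar_negated_negated (D : T.IsLeftUnital e b s) {q t : U} (hq : b q = -q)
    (ht : b t = -t) : b (T q e t) = T t e q := by
  have hs : b (s q) = -s q := by rw [← D.sb, hq, map_neg]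
  have h1 := D.jordan_rho q t
  have h2 := D.K_negated_negated ht hs
  rw [K_apply, D.ss, D.swap, D.ss, hq] at h2
  rw [hs, hq, ht] at h1
  simp only [map_sub, map_smul, map_neg, LinearMap.sub_apply, LinearMap.smul_apply,
    LinearMap.neg_apply] at h1 h2
  apply smul_right_injective U D.three_ne
  linear_combination (norm := module) h1 + h2

/-- In `jordan_mu` for `s h` and `k`, the value of `s` occurs only under `2b - 1`, which is
injective because `3 ≠ 0`. The other parity cases follow this pattern, except that `s_negated_fixed`
reduces to `s_fixed_negated`. -/
theorem s_fixed_fixed (D : T.IsLeftUnital e b s) {h k : U} (hh : b h = h) (hk : b k = k) :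
    s (T h e k) = T (s h) e (s k) := by
  have hs : b (s h) = s h := by rw [← D.sb, hh]
  have ks : b (s k) = s k := by rw [← D.sb, hk]
  have h1 := D.jordan_mu (s h) k
  rw [hs, ks, D.K_fixed (h := (2 : F) • s h - s h) (by rw [map_sub, map_smul, hs])] at h1
  simp only [map_sub, map_smul] at h1
  rw [D.swap (s h), D.ss, hh, D.swap k, ks] at h1
  have h4 := D.bar_fixed_fixed hs ks
  apply eq_of_two_bar_sub_eq D.three_ne D.bb
  linear_combination (norm := module) h1 - (2 : F) • h4

theorem s_fixed_negated (D : T.IsLeftUnital e b s) {h q : U} (hh : b h = h) (hq : b q = -q) :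
    s (T h e q) = T (s h) e (s q) := by
  have hs : b (s h) = s h := by rw [← D.sb, hh]
  have qs : b (s q) = -s q := by rw [← D.sb, hq, map_neg]
  have h1 := D.jordan_mu (s h) q
  rw [hs, qs, D.K_fixed (h := (2 : F) • s h - s h) (by rw [map_sub, map_smul, hs])] at h1
  simp only [map_sub, map_smul, map_neg] at h1
  rw [D.swap (s h), D.ss, hh, D.swap q, qs] at h1
  have h4 := D.negated_fixed qs hs
  simp only [map_neg, LinearMap.neg_apply] at h1
  apply eq_of_two_bar_sub_eq D.three_ne D.bb
  linear_combination (norm := module) h1 - (2 : F) • h4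

theorem s_negated_fixed (D : T.IsLeftUnital e b s) {q h : U} (hq : b q = -q) (hh : b h = h) :
    s (T q e h) = T (s q) e (s h) := by
  have hs : b (s h) = s h := by rw [← D.sb, hh]
  have qs : b (s q) = -s q := by rw [← D.sb, hq, map_neg]
  rw [D.negated_fixed qs hs, D.negated_fixed hq hh, map_sub, map_smul, D.sb,
    D.s_fixed_negated hh hq]

theorem s_negated_negated (D : T.IsLeftUnital e b s) {q t : U} (hq : b q = -q)
    (ht : b t = -t) : s (T q e t) = T (s q) e (s t) := by
  have qs : b (s q) = -s q := by rw [← D.sb, hq, map_neg]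
  have ts : b (s t) = -s t := by rw [← D.sb, ht, map_neg]
  have h1 := D.jordan_mu (s q) t
  have h2 := D.K_negated_negated qs ht
  have h3 := D.bar_negated_negated qs ts
  have h4 := congrArg b h3
  rw [D.bb] at h4
  rw [K_apply] at h2
  rw [qs, ts] at h1
  simp only [map_sub, map_smul, map_neg, LinearMap.neg_apply, LinearMap.sub_apply,
    LinearMap.smul_apply] at h1
  rw [D.swap (s q), D.ss, hq, D.swap t, ts] at h1
  rw [D.swap t, ts] at h2
  simp only [map_neg, LinearMap.neg_apply] at h1 h2
  apply eq_of_two_bar_sub_eq D.three_ne D.bb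
  linear_combination (norm := module) -h1 - h2 - (2 : F) • h3 - (2 : F) • h4

theorem s_left (D : T.IsLeftUnital e b s) (x y : U) : s (T x e y) = T (s x) e (s y) := by
  obtain ⟨h, q, hh, hq, rfl⟩ := exists_fixed_add_negated D.two_ne D.bb x
  obtain ⟨k, t, hk, ht, rfl⟩ := exists_fixed_add_negated D.two_ne D.bb y
  simp only [map_add, LinearMap.add_apply, D.s_fixed_fixed hh hk, D.s_fixed_negated hh ht,
    D.s_negated_fixed hq hk, D.s_negated_negated hq ht]

theorem K_fixed_eq_zero (D : T.IsLeftUnital e b s) {h : U} (hh : b h = h) (x : U) :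
    T.K h e x = 0 := by
  rw [K_apply, D.K_fixed hh, sub_self]

theorem K_add_left (x x' y z : U) : T.K (x + x') y z = T.K x y z + T.K x' y z := by
  simp only [K_apply, map_add, LinearMap.add_apply]; abel

theorem s_K_e (D : T.IsLeftUnital e b s) (u x : U) : s (T.K u e x) = T.K (s u) e (s x) := by
  obtain ⟨h, q, hh, hq, rfl⟩ := exists_fixed_add_negated D.two_ne D.bb u
  obtain ⟨k, t, hk, ht, rfl⟩ := exists_fixed_add_negated D.two_ne D.bb x
  have hs : b (s h) = s h := by rw [← D.sb, hh]
  have qs : b (s q) = -s q := by rw [← D.sb, hq, map_neg]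
  have ks : b (s k) = s k := by rw [← D.sb, hk]
  have ts : b (s t) = -s t := by rw [← D.sb, ht, map_neg]
  have h1 : s (T.K q e t) = T.K (s q) e (s t) := by
    apply smul_right_injective U D.three_ne
    simp only
    rw [D.K_negated_negated qs ts, ← map_smul, D.K_negated_negated hq ht]
    simp only [map_sub, map_smul, D.sb, D.s_left]
  have h2 : s (T.K q e k) = T.K (s q) e (s k) := by
    rw [D.K_negated_fixed qs ks, D.K_negated_fixed hq hk, map_smul, D.sb, D.s_left]
  simp only [map_add, K_add_left, D.K_fixed_eq_zero hh, D.K_fixed_eq_zero hs, h1, h2, map_zero]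

theorem s_K (D : T.IsLeftUnital e b s) (u v x : U) :
    s (T.K u v x) = T.K (s u) (s v) (s x) := by
  apply smul_right_injective U D.two_ne
  simp only
  rw [← D.K_e, ← map_smul, ← D.K_e, D.s_K_e, K_apply T u v, K_apply T (s u), map_sub, D.s_left,
    D.s_left]

theorem s_right_e (D : T.IsLeftUnital e b s) (u v : U) :
    s (T u v e) = T (s u) (s v) e := by
  have h := D.s_K u e v
  rw [K_apply, K_apply, map_sub, D.s_e, D.swap, D.swap, D.s_left, D.sb] at h
  exact sub_left_inj.mp h

theorem eq_rho (D : T.IsLeftUnital e b s) (x : U) : ∃ y, x = T y e e := by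
  -- Since `ρ = 2 - b` and `b² = 1`, the inverse of `ρ` is `(2 + b)/3`.
  refine ⟨(3 : F)⁻¹ • ((2 : F) • x + b x), ?_⟩
  rw [D.rho, map_smul, map_add, map_smul, D.bb]
  have h : (2 : F) • (3 : F)⁻¹ • ((2 : F) • x + b x) - (3 : F)⁻¹ • ((2 : F) • b x + x)
      = ((3 : F)⁻¹ * 3) • x := by module
  rw [h, inv_mul_cancel₀ D.three_ne, one_smul]

/-- `s` is an automorphism of the triple product. -/
theorem s_triple (D : T.IsLeftUnital e b s) (x y z : U) :
    s (T x y z) = T (s x) (s y) (s z) := by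
  -- With `z = wee`, the Jordan identity expresses `xy(wee)` through products having `e` in the
  -- middle or last place, where `s` is already known to be multiplicative.
  obtain ⟨w, rfl⟩ := D.eq_rho z
  have h1 := congrArg s (D.kantor.jordan w e x y e)
  have h2 := D.kantor.jordan (s w) e (s x) (s y) e
  simp only [map_add, map_sub, D.s_left, D.s_right_e, D.s_e] at h1 ⊢
  have h3 : s (T e w y) = T e (s w) (s y) := by
    rw [D.swap, D.swap, D.s_left, D.sb]
  rw [h3] at h1
  linear_combination (norm := module) h2 - h1

end IsLeftUnital

end TripleProduct

/-! ### Skew-alternativity from a left multiplication identity. -/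

namespace Structurable

variable {F A : Type*} [Field F] [AddCommGroup A] [Module F A]

/-- An algebra with involution is skew-alternative as soon as
`L_{qx + x̄q} = L_q V_{x,e} + V_{e,x} L_q` for all skew `q`. -/
theorem skew_alternative (h2 : (2 : F) ≠ 0) (h3 : (3 : F) ≠ 0) {m : A →ₗ[F] A →ₗ[F] A}
    {b : A →ₗ[F] A} (hb : ∀ x, b (b x) = x) (hbm : ∀ x y, b (m x y) = m (b y) (b x))
    (H : ∀ q x z, b q = -q → m (m q x + m (b x) q) z
      = m q (m x z + m z x - m z (b x)) + m (b x) (m q z) + m (m q z) (b x) - m (m q z) x)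
    {q : A} (hq : b q = -q) (x z : A) :
    m (m q x + m x q) z = m q (m x z) + m x (m q z) := by
  have fixed : ∀ {q h : A} (z : A), b q = -q → b h = h →
      m (m q h) z + m (m h q) z = m q (m h z) + m h (m q z) := by
    intro q h z hq hh
    have h1 := H q h z hq
    simp only [hh, map_add, map_sub, LinearMap.add_apply] at h1
    linear_combination (norm := module) h1
  have fixed' : ∀ {q h : A} (z : A), b q = -q → b h = h →
      m z (m h q) + m z (m q h) = m (m z h) q + m (m z q) h := by
    intro q h z hq hh
    have h1 := congrArg b (fixed (b z) hq hh)
    simp only [map_add, hbm, hb, hq, hh, map_neg, LinearMap.neg_apply] at h1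
    linear_combination (norm := module) -h1
  have negated : ∀ {q t : A} (z : A), b q = -q → b t = -t →
      m (m q t) z - m (m t q) z = m q (m t z) + (2 : F) • m q (m z t) - m t (m q z)
        - (2 : F) • m (m q z) t := by
    intro q t z hq ht
    have h1 := H q t z hq
    simp only [ht, map_add, map_sub, map_neg, LinearMap.add_apply, LinearMap.neg_apply] at h1
    linear_combination (norm := module) h1
  obtain ⟨h, t, hh, ht, rfl⟩ := exists_fixed_add_negated h2 hb x
  obtain ⟨k, r, hk, hr, rfl⟩ := exists_fixed_add_negated h2 hb z
  have h1 := fixed k hq hh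
  have h4 := fixed r hq hh
  have h5 : m (m q t) k + m (m t q) k = m q (m t k) + m t (m q k) := by
    linear_combination (norm := module) -negated k hq ht - (2 : F) • fixed' q ht hk
  -- For three skew elements, a combination of permuted instances of `negated` gives six times the
  -- claim.
  have h6 : m (m q t) r + m (m t q) r = m q (m t r) + m t (m q r) := by
    apply smul_right_injective A h2
    apply smul_right_injective A h3
    simp only
    linear_combination (norm := module) -negated r hq ht - negated r ht hq + negated q hr ht
      + negated t hr hq + (3 : F) • negated q ht hr + (3 : F) • negated t hq hr
  simp only [map_add, LinearMap.add_apply]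
  linear_combination (norm := module) h1 + h4 + h5 + h6

end Structurable

/-! ### Invertibility of `μ` and the relations at the left unit. -/

namespace TripleProduct

variable {F U : Type*} [Field F] [AddCommGroup U] [Module F U]

section

variable {T : TripleProduct F U} {e : U}

theorem IsKantor.left_right (hT : T.IsKantor) (he : T.IsLeftUnit e) (u v z : U) :
    T (T u v e) e z = T e (T v u e) z := by
  have h := hT.jordan u v e e z
  rw [he, he] at h
  linear_combination (norm := module) -h

theorem IsKantor.rho_rho (hT : T.IsKantor) (he : T.IsLeftUnit e) (x : U) :
    T.rho e (T.rho e x) = (4 : F) • T.rho e x - (3 : F) • x := by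
  have h := hT.kantor_apply x e e e e
  simp only [K_apply, map_sub, LinearMap.sub_apply, he _] at h
  simp only [rho_apply]
  linear_combination (norm := module) h

theorem IsKantor.mu_mu (hT : T.IsKantor) (he : T.IsLeftUnit e) (x : U) :
    T.mu e (T.mu e x) = T.rho e (T.rho e x) :=
  (hT.left_right he x e e).symm

theorem IsKantor.rho_mu (hT : T.IsKantor) (he : T.IsLeftUnit e) (x : U) :
    T.rho e (T.mu e x) = T.mu e (T.rho e x) :=
  hT.left_right he e x e

theorem IsKantor.isUnit_mu (h3 : (3 : F) ≠ 0) (hT : T.IsKantor) (he : T.IsLeftUnit e) :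
    IsUnit (T.mu e) := by
  have key : ∀ x, T.rho e ((4 : F) • x - T.rho e x) = (3 : F) • x := by
    intro x
    rw [map_sub, map_smul, hT.rho_rho he]
    module
  rw [Module.End.isUnit_iff]
  constructor
  · rw [injective_iff_map_eq_zero]
    intro x hx
    have h := hT.mu_mu he x
    rw [hx, map_zero, hT.rho_rho he] at h
    have h4 := hT.rho_rho he x
    have h5 := congrArg (T.rho e) h
    apply smul_right_injective U h3
    apply smul_right_injective U h3
    simp only [map_zero, map_sub, map_smul] at h5 ⊢
    linear_combination (norm := module) (4 : F) • h5 - (13 : F) • h + (16 : F) • h4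
  · intro y
    have h := (congrArg (T.rho e) (key ((4 : F) • y - T.rho e y))).trans
      ((map_smul _ _ _).trans (congrArg _ (key y)))
    -- As `ρ(4 - ρ) = 3` and `μ² = ρ²`, a preimage of `y` under `μ` is `μ((4 - ρ)² y / 9)`.
    refine ⟨T.mu e ((3 : F)⁻¹ • (3 : F)⁻¹ •
      ((4 : F) • ((4 : F) • y - T.rho e y) - T.rho e ((4 : F) • y - T.rho e y))), ?_⟩
    rw [hT.mu_mu he, map_smul, map_smul, map_smul, map_smul, h,
      smul_smul (3 : F)⁻¹ (3 : F), inv_mul_cancel₀ h3, one_smul, smul_smul, inv_mul_cancel₀ h3,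
      one_smul]

/-- Everything here is algebra in the commuting operators `ρ` and `μ`, except `swap`, which is
`left_right` with the middle variable written as `μ y`. -/
theorem IsKantor.isLeftUnital (h2 : (2 : F) ≠ 0) (h3 : (3 : F) ≠ 0) (hT : T.IsKantor)
    (he : T.IsLeftUnit e) : T.IsLeftUnital e (T.bar e) (T.sigma e) := by
  have hu := hT.isUnit_mu h3 he
  have inj := ((Module.End.isUnit_iff _).mp hu).injective
  have surj := ((Module.End.isUnit_iff _).mp hu).surjective
  have hb : ∀ x, T.bar e x = (2 : F) • x - T.rho e x := fun x => rfl
  have ms : ∀ x, T.mu e (T.sigma e x) = (3 : F) • x - (2 : F) • T.rho e x := by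
    intro x
    have h : T.mu e * T.sigma e = (3 : F) • LinearMap.id - (2 : F) • T.rho e := by
      rw [sigma, ← mul_assoc, Ring.mul_inverse_cancel _ hu, one_mul]
    exact LinearMap.congr_fun h x
  have sr : ∀ x, T.sigma e (T.rho e x) = T.rho e (T.sigma e x) := by
    intro x
    apply inj
    rw [ms, ← hT.rho_mu he, ms, map_sub, map_smul, map_smul]
  have sm : ∀ x, T.sigma e (T.mu e x) = (3 : F) • x - (2 : F) • T.rho e x := by
    intro x
    apply inj
    rw [ms, hT.rho_mu he, map_sub, map_smul, map_smul]
  have ss : ∀ x, T.sigma e (T.sigma e x) = x := by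
    intro x
    apply inj
    apply inj
    rw [ms, ← sr, ← map_smul, ← map_smul, ← map_sub, ms, hT.mu_mu he]
    simp only [map_sub, map_smul, hT.rho_rho he]
    module
  refine ⟨h2, h3, hT, he, fun x => ?_, ss, fun x => ?_, fun x => ?_, fun x => ?_, fun x z => ?_⟩
  · simp only [hb, map_sub, map_smul, hT.rho_rho he]
    module
  · simp only [hb, map_sub, map_smul, sr]
  · rw [bar_apply]
    module
  · have h := congrArg (T.sigma e) (sm x)
    rw [ss, mu_apply] at h
    rw [h]
    simp only [hb, map_sub, map_smul, sr]
    module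
  · obtain ⟨y, rfl⟩ := surj x
    have h := hT.left_right he y e z
    rw [sm, mu_apply, ← h, ← rho_apply]
    congr 2
    simp only [hb, map_sub, map_smul, hT.rho_rho he]
    module

end

/-! ### Reduction to trivial `s`, and the structurable algebra of a Kantor triple system. -/

namespace IsLeftUnital

variable {T : TripleProduct F U} {e : U} {b s : U →ₗ[F] U}

/-- Twisting the middle variable by the automorphism `s` makes the automorphism trivial. -/
theorem twist (D : T.IsLeftUnital e b s) :
    IsLeftUnital (LinearMap.compl₂ T s : TripleProduct F U) e b LinearMap.id where
  two_ne := D.two_ne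
  three_ne := D.three_ne
  kantor :=
    { jordan := fun u v x y z => by
        simp only [LinearMap.compl₂_apply, D.s_triple, D.ss]
        exact D.kantor.jordan _ _ _ _ _
      kantor := fun u v x y => by
        ext z
        have h := D.kantor.kantor_apply u v (s x) y (s z)
        simp only [Module.End.mul_apply, LinearMap.add_apply, L_apply, K_apply,
          LinearMap.compl₂_apply, D.s_triple, D.ss] at h ⊢
        exact h }
  left x := by rw [LinearMap.compl₂_apply, D.s_e, D.left]
  bb := D.bb
  ss _ := rfl
  sb _ := rfl
  rho x := by rw [LinearMap.compl₂_apply, D.s_e, D.rho]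
  mu x := by rw [LinearMap.compl₂_apply, D.mu, D.ss]; rfl
  swap x z := by
    rw [LinearMap.compl₂_apply, LinearMap.compl₂_apply, D.s_e, D.swap, D.ss]; rfl

/-- The multiplication of a left unital Kantor triple system with trivial automorphism. -/
def IsProduct (T : TripleProduct F U) (e : U) (b : U →ₗ[F] U) (m : U →ₗ[F] U →ₗ[F] U) : Prop :=
  ∀ x y, m x y = T (b x) e y - T (b x) (b y) e + T y e x

variable {m : U →ₗ[F] U →ₗ[F] U}

theorem mul_fixed (D : T.IsLeftUnital e b LinearMap.id) (hm : IsProduct T e b m) {h : U} (hh : b h = h) (y : U) : m h y = T h e y := by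
  rw [hm, hh, D.K_fixed hh, D.swap, LinearMap.id_apply, D.bb]
  abel

theorem K_eq_mul (D : T.IsLeftUnital e b LinearMap.id) (hm : IsProduct T e b m) {q : U} (hq : b q = -q) (y : U) : T.K q e y = (2 : F) • m q y := by
  obtain ⟨h, t, hh, ht, rfl⟩ := exists_fixed_add_negated D.two_ne D.bb y
  have h1 := D.K_negated_fixed hq hh
  have h4 := D.negated_fixed hq hh
  have h5 := D.K_negated_negated hq ht
  have h6 := D.bar_negated_negated ht hq
  have h7 := D.swap h q
  have h8 := D.swap t q
  rw [LinearMap.id_apply, hh] at h7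
  rw [LinearMap.id_apply, ht] at h8
  rw [hm, hq, map_add b, hh, ht]
  simp only [LinearMap.id_apply, K_apply, map_add, map_neg, LinearMap.add_apply,
    LinearMap.neg_apply] at *
  apply smul_right_injective U D.three_ne
  simp only
  linear_combination (norm := module) -(3 : F) • h1 + (6 : F) • h4 - (6 : F) • h7
    + (3 : F) • h5 - (6 : F) • h6 + (6 : F) • h8

theorem left_eq (D : T.IsLeftUnital e b LinearMap.id) (hm : IsProduct T e b m) (x y : U) :
    T x e y = m x y + m y x - m y (b x) := by
  obtain ⟨h, q, hh, hq, rfl⟩ := exists_fixed_add_negated D.two_ne D.bb x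
  obtain ⟨k, t, hk, ht, rfl⟩ := exists_fixed_add_negated D.two_ne D.bb y
  have h1 := D.negated_fixed hq hk
  have h4 := D.K_negated_fixed hq hk
  rw [K_eq_mul D hm hq, LinearMap.id_apply] at h4
  have h5 := D.K_negated_negated ht hq
  rw [K_eq_mul D hm ht, LinearMap.id_apply] at h5
  have h7 := D.K_negated_negated hq ht
  rw [K_eq_mul D hm hq, LinearMap.id_apply] at h7
  simp only [map_add, map_neg, LinearMap.add_apply, hh, hq, mul_fixed D hm hh,
    mul_fixed D hm hk]
  simp only [D.bar_negated_negated ht hq, D.bar_negated_negated hq ht] at h5 h7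
  apply smul_right_injective U D.two_ne
  apply smul_right_injective U D.three_ne
  simp only
  linear_combination (norm := module) (6 : F) • h1 - (3 : F) • h4 - h7 - (2 : F) • h5

end IsLeftUnital

end TripleProduct

namespace TripleProduct

namespace IsLeftUnital

variable {F U : Type*} [Field F] [AddCommGroup U] [Module F U]
  {T : TripleProduct F U} {e : U} {b s : U →ₗ[F] U} {m : U →ₗ[F] U →ₗ[F] U}

theorem e_mul (D : T.IsLeftUnital e b LinearMap.id) (hm : IsProduct T e b m) (x : U) :
    m e x = x := by
  rw [mul_fixed D hm D.b_e, D.left]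

theorem mul_e (D : T.IsLeftUnital e b LinearMap.id) (hm : IsProduct T e b m) (x : U) :
    m x e = x := by
  rw [hm, D.b_e, D.left]; abel

theorem bar_mul (D : T.IsLeftUnital e b LinearMap.id) (hm : IsProduct T e b m) (x y : U) :
    b (m x y) = m (b y) (b x) := by
  obtain ⟨h, q, hh, hq, rfl⟩ := exists_fixed_add_negated D.two_ne D.bb x
  obtain ⟨k, t, hk, ht, rfl⟩ := exists_fixed_add_negated D.two_ne D.bb y
  have h1 := D.bar_fixed_fixed hh hk
  rw [← mul_fixed D hm hh, ← mul_fixed D hm hk] at h1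
  have mixed : ∀ {q h : U}, b q = -q → b h = h → b (m q h) = -m h q := by
    intro q h hq hh
    have h2 := congrArg b (D.K_negated_fixed hq hh)
    rw [K_eq_mul D hm hq, LinearMap.id_apply, ← mul_fixed D hm hh, map_smul, map_smul, D.bb] at h2
    apply smul_right_injective U D.two_ne
    simp only
    linear_combination (norm := module) h2
  have h3 := mixed hq hk
  have h4 := congrArg b (mixed ht hh)
  rw [D.bb, map_neg] at h4
  have h5 := congrArg b (D.K_negated_negated hq ht)
  have h6 := D.K_negated_negated ht hq
  rw [K_eq_mul D hm hq, LinearMap.id_apply] at h5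
  rw [K_eq_mul D hm ht, LinearMap.id_apply] at h6
  simp only [map_sub, map_smul, D.bar_negated_negated ht hq,
    D.bar_negated_negated hq ht] at h5 h6
  have h7 : b (m q t) = m t q := by
    apply smul_right_injective U D.two_ne
    apply smul_right_injective U D.three_ne
    simp only
    linear_combination (norm := module) h5 - h6
  simp only [map_add, map_neg, LinearMap.add_apply, LinearMap.neg_apply, hh, hk, hq, ht]
  linear_combination (norm := module) h1 + h3 + h7 + h4

/-- The element `w = K(x, y)e` is skew, and `K(w, e)` equals both `2K(x, y)` by `K_e` and `2L_w` by
`K_eq_mul`. -/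
theorem K_eq_mul_bar (D : T.IsLeftUnital e b LinearMap.id) (hm : IsProduct T e b m)
    (x y z : U) : T.K x y z = m (m x (b y) - m y (b x)) z := by
  have h := D.K_e x y z
  have hw : T.K x y e = m x (b y) - m y (b x) := by
    rw [K_apply, left_eq D hm, left_eq D hm]; abel
  rw [hw, K_eq_mul D hm (by simp only [map_sub, bar_mul D hm, D.bb]; abel)] at h
  exact (smul_right_injective U D.two_ne h).symm

theorem right_e_eq (D : T.IsLeftUnital e b LinearMap.id) (hm : IsProduct T e b m) (u v : U) :
    T u v e = m (b v) u + m u (b v) - m (b u) v := by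
  have h := K_eq_mul_bar D hm u e v
  have h1 := D.swap v u
  rw [LinearMap.id_apply, left_eq D hm, D.bb] at h1
  rw [K_apply, h1, D.b_e, mul_e D hm, e_mul D hm] at h
  simp only [map_sub, LinearMap.sub_apply] at h
  linear_combination (norm := module) h

/-- `L(u, v) + L(v, u)` is the left multiplication by `u v̄ + v ū`. -/
theorem add_swap (D : T.IsLeftUnital e b LinearMap.id) (hm : IsProduct T e b m) (u v z : U) :
    T u v z + T v u z = m (m u (b v) + m v (b u)) z := by
  -- The pair `(a, e)` imitates `(u, v)`: `uve = aee` and `vue = eae`. Comparing Jordan identities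
  -- for the two pairs gives `L(u, v) + L(v, u) = L(a, e) + L(e, a)`, which is left multiplication
  -- by the fixed element `a + ā`.
  obtain ⟨a, ha⟩ := D.eq_rho (T u v e)
  have hr : ∀ x, T e x e = b (T x e e) := by
    intro x
    rw [D.mu, D.rho, map_sub, map_smul, D.bb, LinearMap.id_apply]
  have hva : T v u e = T e a e := by
    have h1 := right_e_eq D hm u v
    have h4 := congrArg b h1
    simp only [map_add, map_sub, bar_mul D hm, D.bb] at h4
    rw [hr, ← ha, h4, right_e_eq D hm]
  have h1 := D.kantor.jordan u v z e e
  have h4 := D.kantor.jordan a e z e e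
  have h5 := D.kantor.jordan u v e z e
  have h6 := D.kantor.jordan a e e z e
  rw [D.rho z, D.rho] at h1 h4
  rw [D.mu z, D.mu] at h5 h6
  rw [← ha, ← hva] at h4
  rw [hva] at h1
  rw [ha] at h5
  simp only [map_sub, map_smul, LinearMap.id_apply] at h1 h4 h5 h6
  have h7 : T u v z - T a e z = T e a z - T v u z := by
    apply eq_of_two_bar_sub_eq D.three_ne D.bb
    simp only [map_sub]
    rw [hva] at h4
    linear_combination (norm := module) h5 - h6 + (2 : F) • h1 - (2 : F) • h4
  have h8 : m u (b v) + m v (b u) = a + b a := by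
    have h9 := right_e_eq D hm u v
    have h10 := right_e_eq D hm v u
    rw [ha, D.rho] at h9
    rw [hva, D.mu, LinearMap.id_apply] at h10
    linear_combination (norm := module) -h9 - h10
  have h9 := mul_fixed D hm (h := a + b a) (by rw [map_add, D.bb, add_comm]) z
  rw [h8, h9]
  have h10 := D.swap a z
  rw [LinearMap.id_apply] at h10
  simp only [map_add, LinearMap.add_apply]
  linear_combination (norm := module) h7 + h10

/-- The defect `T - V` is symmetric in its outer variables and alternates in sign under exchange of
the first two. Composing six such transpositions carries it to its negative, so it vanishes. -/
theorem eq_V (D : T.IsLeftUnital e b LinearMap.id) (hm : IsProduct T e b m) (x y z : U) :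
    T x y z = Structurable.V m b x y z := by
  have sym : ∀ x y z, T x y z - Structurable.V m b x y z
      = T z y x - Structurable.V m b z y x := by
    intro x y z
    have h := K_eq_mul_bar D hm x z y
    rw [K_apply] at h
    simp only [map_sub, LinearMap.sub_apply] at h
    rw [Structurable.V_apply, Structurable.V_apply]
    linear_combination (norm := module) h
  have skew : ∀ x y z, T x y z - Structurable.V m b x y z
      = -(T y x z - Structurable.V m b y x z) := by
    intro x y z
    have h := add_swap D hm x y z
    simp only [map_add, LinearMap.add_apply] at h
    rw [Structurable.V_apply, Structurable.V_apply]
    linear_combination (norm := module) h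
  apply smul_right_injective U D.two_ne
  simp only
  linear_combination (norm := module) skew x y z - sym y x z - skew z x y + sym x z y
    + skew y z x - sym z y x

theorem isStructurable (D : T.IsLeftUnital e b LinearMap.id) (hm : IsProduct T e b m) :
    Structurable.IsStructurable m b e where
  one_mul := e_mul D hm
  mul_one := mul_e D hm
  bar_bar := D.bb
  bar_mul := bar_mul D hm
  skew_assoc x y z := by
    have hq : b (x - b x) = -(x - b x) := by
      rw [map_sub, D.bb]; abel
    have h := Structurable.skew_alternative D.two_ne D.three_ne D.bb (bar_mul D hm)
      (fun q x z hq => ?_) hq y z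
    · simp only [Structurable.assoc, map_add, map_sub, LinearMap.add_apply,
        LinearMap.sub_apply] at h ⊢
      linear_combination (norm := module) h
    -- Here `K(q, e) = 2L_q` and `K(2q·x, e)` is left multiplication by `2(q·x + x̄·q)`, so the
    -- Kantor identity is twice the hypothesis of `skew_alternative`.
    · have h1 := D.kantor.kantor_apply q e x e z
      have h4 := D.swap x (m q z)
      rw [LinearMap.id_apply] at h4
      rw [K_eq_mul_bar D hm, K_eq_mul D hm hq, K_eq_mul D hm hq, K_eq_mul D hm hq, D.b_e,
        mul_e D hm, e_mul D hm, map_smul (T e x), h4, left_eq D hm, left_eq D hm, map_smul b,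
        bar_mul D hm, hq, D.bb] at h1
      apply smul_right_injective U D.two_ne
      simp only [map_add, map_sub, map_smul, map_neg, LinearMap.add_apply, LinearMap.sub_apply,
        LinearMap.smul_apply, LinearMap.neg_apply] at h1 ⊢
      linear_combination (norm := module) h1
  V_bracket u v x y := by
    ext z
    simp only [LinearMap.sub_apply, Ring.lie_def, Module.End.mul_apply, ← eq_V D hm]
    rw [D.kantor.jordan]
    abel

end IsLeftUnital

theorem IsKantor.structurable {F U : Type*} [Field F] [AddCommGroup U] [Module F U]
    {T : TripleProduct F U} {e : U} (h2 : (2 : F) ≠ 0) (h3 : (3 : F) ≠ 0)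
    (hT : T.IsKantor) (he : T.IsLeftUnit e) :
    Structurable.IsStructurable (T.mul e) (T.bar e) e ∧
      Structurable.IsInvolutiveAutomorphism (T.mul e) (T.bar e) (T.sigma e) ∧
      T = Structurable.triple (T.mul e) (T.bar e) (T.sigma e) := by
  have D := hT.isLeftUnital h2 h3 he
  have hm : IsLeftUnital.IsProduct (LinearMap.compl₂ T (T.sigma e)) e (T.bar e) (T.mul e) := by
    intro x y
    rw [LinearMap.compl₂_apply, LinearMap.compl₂_apply, LinearMap.compl₂_apply, D.s_e]
    rfl
  refine ⟨D.twist.isStructurable hm, ⟨fun x y => ?_, D.sb, D.ss⟩, ?_⟩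
  · rw [mul_apply, mul_apply]
    simp only [map_add, map_sub, D.s_triple, D.sb, D.s_e]
  · ext x y z
    rw [Structurable.triple_apply, ← D.twist.eq_V hm, LinearMap.compl₂_apply, D.ss]

end TripleProduct

/-! ### From structurable algebras to Kantor triple systems. -/

namespace Structurable

variable {F A : Type*} [Field F] [AddCommGroup A] [Module F A]
  {m : A →ₗ[F] A →ₗ[F] A} {b : A →ₗ[F] A} {e : A} {s : Module.End F A}

namespace IsStructurable

theorem bar_one (S : IsStructurable m b e) : b e = e := by
  have h := S.bar_mul (b e) e
  rw [S.mul_one, S.bar_bar, S.mul_one] at h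
  exact h.symm

theorem skew_alternative (S : IsStructurable m b e) (h2 : (2 : F) ≠ 0) {q : A} (hq : b q = -q)
    (x z : A) : m (m q x) z + m (m x q) z = m q (m x z) + m x (m q z) := by
  have h := S.skew_assoc q x z
  simp only [assoc, hq, sub_neg_eq_add, map_add, map_sub, map_neg, LinearMap.add_apply,
    LinearMap.sub_apply, LinearMap.neg_apply] at h
  apply smul_right_injective A h2
  simp only
  linear_combination (norm := module) h

theorem skew_alternative_right (S : IsStructurable m b e) (h2 : (2 : F) ≠ 0) {q : A}
    (hq : b q = -q) (x z : A) : m z (m x q) + m z (m q x) = m (m z x) q + m (m z q) x := by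
  have h := congrArg b (S.skew_alternative h2 hq (b x) (b z))
  simp only [map_add, S.bar_mul, S.bar_bar, hq, map_neg, LinearMap.neg_apply] at h
  linear_combination (norm := module) -h

theorem V_V (S : IsStructurable m b e) (u v x y z : A) :
    V m b u v (V m b x y z) = V m b (V m b u v x) y z - V m b x (V m b v u y) z
      + V m b x y (V m b u v z) := by
  have h := LinearMap.congr_fun (S.V_bracket u v x y) z
  simp only [LinearMap.sub_apply, Ring.lie_def, Module.End.mul_apply] at h
  linear_combination (norm := module) h

end IsStructurable

end Structurable

namespace Structurable

variable {F A : Type*} [Field F] [AddCommGroup A] [Module F A]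
  {m : A →ₗ[F] A →ₗ[F] A} {b : A →ₗ[F] A} {e : A} {s : Module.End F A}

namespace IsStructurable

/-- `L_q V_{x,e} + V_{e,x} L_q = L_{qx + x̄q}` for skew `q`. -/
theorem mul_V_one (S : IsStructurable m b e) (h2 : (2 : F) ≠ 0) {q : A} (hq : b q = -q)
    (x z : A) : m q (V m b x e z) + V m b e x (m q z) = m (m q x + m (b x) q) z := by
  obtain ⟨h, t, hh, ht, rfl⟩ := exists_fixed_add_negated h2 S.bar_bar x
  have h1 := S.skew_alternative h2 hq h z
  have h4 := S.skew_alternative h2 hq t z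
  have h5 := S.skew_alternative_right h2 ht z q
  simp only [V_apply, S.bar_one, S.mul_one, S.one_mul]
  simp only [hh, ht, map_add, map_sub, map_neg, LinearMap.add_apply, LinearMap.neg_apply]
  linear_combination (norm := module) -h1 + h4 + (2 : F) • h5

theorem V_one_left (S : IsStructurable m b e) (x z : A) : V m b e x z = V m b (b x) e z := by
  simp only [V_apply, S.bar_one, S.mul_one, S.one_mul, S.bar_bar]

theorem mul_one_V (S : IsStructurable m b e) (h2 : (2 : F) ≠ 0) {q : A} (hq : b q = -q)
    (x z : A) : m q (V m b e x z) + V m b x e (m q z) = m (m q (b x) + m x q) z := by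
  have h := S.mul_V_one h2 hq (b x) z
  rwa [← S.V_one_left, S.V_one_left (b x), S.bar_bar] at h

/-- Evaluation of `mul_V` at `e`. It identifies the multiplier once some multiplier is known to
exist. -/
theorem mul_V_at_one (S : IsStructurable m b e) (h2 : (2 : F) ≠ 0) {q : A} (hq : b q = -q)
    (x y : A) :
    m q (V m b x y e) + V m b y x q = m (m q x) (b y) + m y (m (b x) q) := by
  have h1 := S.skew_alternative_right h2 hq (b x) y
  have h4 := S.skew_alternative h2 hq y (b x)
  obtain ⟨h, t, hh, ht, rfl⟩ := exists_fixed_add_negated h2 S.bar_bar x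
  obtain ⟨k, r, hk, hr, rfl⟩ := exists_fixed_add_negated h2 S.bar_bar y
  have h5 := S.skew_alternative_right h2 hr h q
  have h6 := S.skew_alternative_right h2 ht k q
  simp only [V_apply, S.mul_one, S.one_mul]
  simp only [hh, ht, hk, hr, map_add, map_sub, map_neg, LinearMap.add_apply,
    LinearMap.neg_apply] at h1 h4 ⊢
  linear_combination (norm := module) -h1 - h4 - (2 : F) • h5 + (2 : F) • h6

/-- `L_q V_{x,y} + V_{y,x} L_q` is a left multiplication for skew `q`. -/
theorem mul_V (S : IsStructurable m b e) (h2 : (2 : F) ≠ 0) (h3 : (3 : F) ≠ 0) {q : A}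
    (hq : b q = -q) (x y z : A) :
    m q (V m b x y z) + V m b y x (m q z) = m (m (m q x) (b y) + m y (m (b x) q)) z := by
  have skew : ∀ w, b (m q w + m (b w) q) = -(m q w + m (b w) q) := by
    intro w
    simp only [map_add, S.bar_mul, hq, S.bar_bar, map_neg, LinearMap.neg_apply]
    abel
  -- For a first index `V_{a,e}e`, the bracket identity rewrites `V_{x,y}` and `V_{y,x}` through
  -- operators with an index `e`, and `mul_V_one` and `mul_one_V` move `L_q` past these. The
  -- explicit `R` is not simplified, since `eval` recovers it at `z = e`.
  have main : ∀ a, ∃ R, ∀ z,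
      m q (V m b (V m b a e e) y z) + V m b y (V m b a e e) (m q z) = m R z := by
    intro a
    refine ⟨m q (b (V m b e a y)) + m (V m b e a y) q
      + (m (m q a + m (b a) q) (b y) + m y (m q a + m (b a) q))
      - (m (m q (b y) + m y q) a + m (b a) (m q (b y) + m y q)), fun z => ?_⟩
    have hr : b (m q (b y) + m y q) = -(m q (b y) + m y q) := by
      have := skew (b y)
      rwa [S.bar_bar] at this
    have e1 := congrArg (m q) (S.V_V a e e y z)
    have e2 := S.V_V e a y e (m q z)
    have e3 := S.mul_one_V h2 hq (V m b e a y) z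
    have e4 := S.mul_V_one h2 hq a (V m b e y z)
    have e5 := congrArg (V m b y e) (S.mul_V_one h2 hq a z)
    have e6 := S.mul_one_V h2 (skew a) y z
    have e7 := congrArg (V m b e a) (S.mul_one_V h2 hq y z)
    have e8 := S.mul_one_V h2 hq y (V m b a e z)
    have e9 := S.mul_V_one h2 hr a z
    generalize m q a + m (b a) q = q' at *
    generalize m q (b y) + m y q = r at *
    rw [map_add (V m b y e)] at e5
    rw [map_add (V m b e a)] at e7
    rw [map_add (m q), map_sub (m q)] at e1
    rw [map_sub m, map_add m, LinearMap.sub_apply, LinearMap.add_apply, ← e3, ← e6, ← e9]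
    linear_combination (norm := module) -e1 + e2 + e4 + e5 - e7 - e8
  have eval : ∀ a, m q (V m b (V m b a e e) y z) + V m b y (V m b a e e) (m q z)
      = m (m (m q (V m b a e e)) (b y) + m y (m (b (V m b a e e)) q)) z := by
    intro a
    obtain ⟨R, hR⟩ := main a
    have h := hR e
    rw [S.mul_one, S.mul_one, S.mul_V_at_one h2 hq] at h
    rw [hR, h]
  -- The map `a ↦ V_{a,e}e = 2a - ā` is onto because `3` is invertible, so the special first index
  -- is no restriction.
  have hx : (3 : F) • x = V m b ((2 : F) • x + b x) e e := by
    rw [V_apply]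
    simp only [S.bar_one, S.mul_one, S.one_mul]
    simp only [map_add, map_smul, S.bar_bar]
    module
  have h := eval ((2 : F) • x + b x)
  rw [← hx] at h
  apply smul_right_injective A h3
  simp only [map_smul, map_add, LinearMap.add_apply, LinearMap.smul_apply] at h ⊢
  linear_combination (norm := module) h

end IsStructurable

namespace IsInvolutiveAutomorphism

theorem map_one (N : IsInvolutiveAutomorphism m b s) (S : IsStructurable m b e) : s e = e := by
  have h := N.map_mul e (s e)
  rwa [S.one_mul, N.involutive, S.mul_one, eq_comm] at h

theorem map_V (N : IsInvolutiveAutomorphism m b s) (x y z : A) :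
    s (V m b x y z) = V m b (s x) (s y) (s z) := by
  simp only [V_apply, map_add, map_sub, N.map_mul, N.map_bar]

theorem K_triple_apply (x y z : A) :
    (triple m b s).K x y z = m (m x (b y) - m y (b x)) (s z) := by
  simp only [TripleProduct.K_apply, triple_apply, V_apply, map_sub, LinearMap.sub_apply]
  abel

/-- The triple product of a structurable algebra, twisted by an involutive automorphism. -/
theorem isKantor_triple (N : IsInvolutiveAutomorphism m b s) (S : IsStructurable m b e)
    (h2 : (2 : F) ≠ 0) (h3 : (3 : F) ≠ 0) : (triple m b s).IsKantor where
  jordan u v x y z := by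
    simp only [triple_apply, N.map_V, N.involutive]
    exact S.V_V _ _ _ _ _
  kantor u v x y := by
    ext z
    have hq : b (m u (b v) - m v (b u)) = -(m u (b v) - m v (b u)) := by
      simp only [map_sub, S.bar_mul, S.bar_bar]; abel
    have h := S.mul_V h2 h3 hq (s x) y (s z)
    simp only [Module.End.mul_apply, LinearMap.add_apply, K_triple_apply,
      TripleProduct.L_apply, triple_apply, N.map_V, N.involutive]
    rw [h, S.bar_mul, hq, map_neg, map_neg, sub_neg_eq_add]

end IsInvolutiveAutomorphism

end Structurable

/-! ### The correspondence in both directions. -/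

theorem theorem2p7 {F : Type*} [Field F] (h2 : ringChar F ≠ 2) (h3 : ringChar F ≠ 3)
    {U : Type*} [AddCommGroup U] [Module F U] :
    (∀ (T : TripleProduct F U) (e : U), T.IsKantor → T.IsLeftUnit e →
      IsUnit (T.mu e) ∧
      Structurable.IsStructurable (T.mul e) (T.bar e) e ∧
      Structurable.IsInvolutiveAutomorphism (T.mul e) (T.bar e) (T.sigma e) ∧
      T = Structurable.triple (T.mul e) (T.bar e) (T.sigma e) ∧
      ∀ x y z : U, T x y z =
        T.mul e (T.mul e x (T.sigma e (T.bar e y))) z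
          + T.mul e (T.mul e z (T.sigma e (T.bar e y))) x
          - T.mul e (T.mul e z (T.bar e x)) (T.sigma e y)) ∧
    (∀ (m : U →ₗ[F] U →ₗ[F] U) (b : U →ₗ[F] U) (e : U) (s : Module.End F U),
      Structurable.IsStructurable m b e →
      Structurable.IsInvolutiveAutomorphism m b s →
      (Structurable.triple m b s).IsKantor ∧
      (Structurable.triple m b s).IsLeftUnit e ∧
      (∀ x y z : U, Structurable.triple m b s x y z =
        m (m x (s (b y))) z + m (m z (s (b y))) x - m (m z (b x)) (s y)) ∧
      IsUnit ((Structurable.triple m b s).mu e) ∧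
      s = (Structurable.triple m b s).sigma e ∧
      b = (Structurable.triple m b s).bar e ∧
      m = (Structurable.triple m b s).mul e) := by
  have two_ne : (2 : F) ≠ 0 := Ring.two_ne_zero h2
  have three_ne : (3 : F) ≠ 0 := three_ne_zero_of_ringChar h3
  refine ⟨fun T e hT he => ?_, fun m b e s S N => ?_⟩
  · obtain ⟨h, h', h''⟩ := hT.structurable two_ne three_ne he
    refine ⟨hT.isUnit_mu three_ne he, h, h', h'', fun x y z => ?_⟩
    have hxyz : T x y z = Structurable.triple (T.mul e) (T.bar e) (T.sigma e) x y z := by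
      rw [← h'']
    rw [hxyz, Structurable.triple_apply, Structurable.V_apply, h'.map_bar]
  · have hT := N.isKantor_triple S two_ne three_ne
    have he : (Structurable.triple m b s).IsLeftUnit e := by
      intro x
      simp only [Structurable.triple_apply, N.map_one S, Structurable.V_apply, S.bar_one,
        S.mul_one, S.one_mul]
      abel
    have hu := hT.isUnit_mu three_ne he
    have hb : b = (Structurable.triple m b s).bar e := by
      ext x
      simp only [TripleProduct.bar_apply, Structurable.triple_apply, N.map_one S,
        Structurable.V_apply, S.bar_one, S.mul_one, S.one_mul]
      module
    have hs : s = (Structurable.triple m b s).sigma e := by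
      -- Cancelling the invertible `μ` from `μs = 3 - 2ρ` recovers `s`.
      have h : (Structurable.triple m b s).mu e * s
          = (3 : F) • LinearMap.id - (2 : F) • (Structurable.triple m b s).rho e := by
        ext x
        simp only [Module.End.mul_apply, LinearMap.sub_apply, LinearMap.smul_apply,
          LinearMap.id_apply, TripleProduct.mu_apply, TripleProduct.rho_apply,
          Structurable.triple_apply, N.map_one S, N.involutive, Structurable.V_apply, S.bar_one,
          S.mul_one, S.one_mul]
        module
      rw [TripleProduct.sigma, ← h, ← mul_assoc, Ring.inverse_mul_cancel _ hu, one_mul]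
    refine ⟨hT, he, fun x y z => ?_, hu, hs, hb, ?_⟩
    · rw [Structurable.triple_apply, Structurable.V_apply, N.map_bar]
    · ext x y
      rw [TripleProduct.mul_apply, ← hs, ← hb]
      simp only [Structurable.triple_apply, N.map_one S, N.involutive, Structurable.V_apply,
        S.bar_one, S.bar_bar, S.mul_one, S.one_mul]
      abel
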